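/- Let $\mathbb{L}=(V,\oplus)$ be a finite join-semilattice with its natural order $u\le v\iff u\oplus v=v$. Suppose that $\mathbb{L}$ is cycle-free, i.e. its comparability graph (vertex set $V$, two distinct elements adjacent iff they are comparable) is chordal (has no induced cycle of length at least $4$), and let $\omega$ be the height of $\mathbb{L}$, i.e. the maximum cardinality of a chain in $V$. Let $n,f\ge 0$ be integers with $n>(\omega+1)f$. Then Byzantine semilattice agreement on $\mathbb{L}$ can be solved in the asynchronous model by $n$ processors of which up to $f$ are Byzantine faulty. That is, there is a deterministic message-passing algorithm (with finitely many local states and finitely many possible message contents) for $n$ processors $P$ with the following property. The processors are connected by reliable point-to-point links on which the recipient knows the true sender; there is no clock. Let $F\subseteq P$ with $|F|\le f$ be any set of faulty processors, let $x_i\in V$ be any inputs, and consider any execution in which the processors in $F$ send arbitrary messages under their own identity, while every message sent between two non-faulty processors is received after an arbitrary but finite time. Then every non-faulty processor $i\in P\setminus F$ irrevocably decides, after finitely many steps, on an output $y_i\in V$ such that * (agreement) $y_i\le y_j$ or $y_j\le y_i$ for all $i,j\in P\setminus F$; * (validity) for every $i\in P\setminus F$ there is some $j\in P\setminus F$ with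 $x_j\le y_i$, and $y_i\le\bigoplus\{x_k : k\in P\setminus F\}$. -/

import Mathlib

universe u

/-- A graph is chordal if it has no induced cycle of length at least four. -/
def SimpleGraph.IsChordal {V : Type u} (G : SimpleGraph V) : Prop :=
  ∀ k : ℕ, 4 ≤ k → IsEmpty (SimpleGraph.cycleGraph k ↪g G)

/-- The comparability graph of a partial order: distinct comparable elements are adjacent. -/
def comparabilityGraph (V : Type u) [PartialOrder V] : SimpleGraph V where
  Adj u v := u ≠ v ∧ (u ≤ v ∨ v ≤ u)
  symm := ⟨fun _ _ h => ⟨h.1.symm, h.2.symm⟩⟩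
  loopless := ⟨fun _ h => h.1 rfl⟩

/-- A partial order is cycle-free if its comparability graph is chordal. -/
def IsCycleFree (V : Type u) [PartialOrder V] : Prop :=
  (comparabilityGraph V).IsChordal

namespace AsyncModel

/-- A deterministic message-passing algorithm for `n` processors with inputs and outputs in `V`.
Every processor is an event-driven state machine. It knows its own identity and learns the true
identity of the sender of every message that it receives; it has no clock. -/
structure Algorithm (n : ℕ) (V : Type u) where
  /-- local states -/
  State : Type u
  /-- contents of messages -/
  Message : Type u
  /-- `start i x` is the initial state of processor `i` with input `x`, together with the
  messages (recipient, content) that it sends at the beginning. -/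
  start : Fin n → V → State × List (Fin n × Message)
  /-- `receive i s j m` is the new state of processor `i` when it receives the content `m` from
  processor `j` in state `s`, together with the messages that it sends in reaction. -/
  receive : Fin n → State → Fin n → Message → State × List (Fin n × Message)
  /-- the output value, if the processor has decided -/
  output : State → Option V

/-- A message on a point-to-point link. -/
@[ext] structure Envelope (n : ℕ) (M : Type u) where
  src : Fin n
  dst : Fin n
  content : M

/-- A global configuration: the local states (those of faulty processors are meaningless), and
the messages that non-faulty processors have sent and that have not been received yet. -/
structure Config {n : ℕ} {V : Type u} (A : Algorithm n V) where
  state : Fin n → A.State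
  pending : Multiset (Envelope n A.Message)

variable {n : ℕ} {V : Type u}

/-- The envelopes for a list of messages sent by processor `i`. -/
def outgoing {M : Type u} (i : Fin n) (l : List (Fin n × M)) : Multiset (Envelope n M) :=
  ((l.map fun p => (⟨i, p.1, p.2⟩ : Envelope n M) : List (Envelope n M)) :
    Multiset (Envelope n M))

/-- The initial configuration for the set `F` of faulty processors and the inputs `x`. -/
def initial (A : Algorithm n V) (F : Finset (Fin n)) (x : Fin n → V) : Config A where
  state i := (A.start i (x i)).1
  pending := ∑ i ∈ Fᶜ, outgoing i (A.start i (x i)).2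

/-- Whether the receipt of `e` is possible: the recipient is non-faulty, and either
`e` is in transit, or its sender is faulty (a faulty processor may send anything to anyone at any
time, but only under its own identity). -/
def CanReceive {A : Algorithm n V} (F : Finset (Fin n)) (c : Config A)
    (e : Envelope n A.Message) : Prop :=
  e.dst ∉ F ∧ (e.src ∈ F ∨ e ∈ c.pending)

open Classical in
/-- The configuration after the recipient of `e` has received and processed `e`. -/
noncomputable def deliver {A : Algorithm n V} (c : Config A) (e : Envelope n A.Message) :
    Config A where
  state := Function.update c.state e.dst
    (A.receive e.dst (c.state e.dst) e.src e.content).1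
  pending := c.pending.erase e +
    outgoing e.dst (A.receive e.dst (c.state e.dst) e.src e.content).2

/-- A schedule of the adversary says which message, if any, is received at each time step. -/
abbrev Schedule (A : Algorithm n V) : Type u := ℕ → Option (Envelope n A.Message)

/-- The execution of `A` that a schedule determines. -/
noncomputable def run (A : Algorithm n V) (F : Finset (Fin n)) (x : Fin n → V)
    (σ : Schedule A) : ℕ → Config A
  | 0 => initial A F x
  | t + 1 => (σ t).elim (run A F x σ t) (deliver (run A F x σ t))

/-- Admissible schedules: every receipt is possible when it happens, and every message from a
non-faulty to a non-faulty processor is received after an arbitrary but finite time. -/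
structure IsAdmissible (A : Algorithm n V) (F : Finset (Fin n)) (x : Fin n → V)
    (σ : Schedule A) : Prop where
  possible : ∀ t e, σ t = some e → CanReceive F (run A F x σ t) e
  delivered : ∀ t, ∀ e ∈ (run A F x σ t).pending, e.dst ∉ F → ∃ t' ≥ t, σ t' = some e

/-- Processor `i` irrevocably decides on `y` after finitely many steps of the execution. -/
def Decides (A : Algorithm n V) (F : Finset (Fin n)) (x : Fin n → V) (σ : Schedule A)
    (i : Fin n) (y : V) : Prop :=
  ∃ T : ℕ, (∀ t < T, A.output ((run A F x σ t).state i) = none) ∧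
    ∀ t ≥ T, A.output ((run A F x σ t).state i) = some y

/-- The constraints of Byzantine semilattice agreement on the inputs `x` and outputs `y` of the
processors outside `F`: the outputs form a chain, and each of them lies above the input of some
non-faulty processor and below the join of the inputs of the non-faulty processors. -/
structure IsSemilatticeAgreement [SemilatticeSup V] (F : Finset (Fin n)) (x y : Fin n → V) :
    Prop where
  agreement : ∀ i ∉ F, ∀ j ∉ F, y i ≤ y j ∨ y j ≤ y i
  validity_lower : ∀ i ∉ F, ∃ j ∉ F, x j ≤ y i
  validity_upper : ∀ i (hi : i ∉ F), y i ≤ Fᶜ.sup' ⟨i, Finset.mem_compl.mpr hi⟩ x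

/-- `A` solves Byzantine semilattice agreement with up to `f` faulty processors in the
asynchronous model. -/
def SolvesSemilatticeAgreement [SemilatticeSup V] (A : Algorithm n V) (f : ℕ) : Prop :=
  ∀ F : Finset (Fin n), F.card ≤ f → ∀ x : Fin n → V, ∀ σ : Schedule A, IsAdmissible A F x σ →
    ∃ y : Fin n → V, (∀ i ∉ F, Decides A F x σ i (y i)) ∧ IsSemilatticeAgreement F x y

end AsyncModel

/-!
# Byzantine semilattice agreement on cycle-free semilattices

For height at most one there is at most one value and nothing to do, so let `3 * f < n`. The proof
combines a communication protocol, which knows nothing about the order on `V`, with a monotone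
choice of an output from what the protocol delivers.

*Protocol* (`viewAlgorithm`). All inputs are broadcast reliably by means of the messages `init`,
`echo` and `ready`: non-faulty processors never deliver different inputs of the same processor
(`delivered_unique`), they deliver the true inputs of non-faulty processors
(`eq_input_of_mem_delivered`, `eventually_input_mem_delivered`), and what one of them delivers, all
deliver eventually (`eventually_mem_delivered_of_mem_delivered`). The view of a processor is the
set of pairs (processor, input) that it has delivered. Whenever this set has at least `n - f`
members, the processor announces it to everyone, and a processor decides on a view as soon as
`n - f` processors have announced exactly this view. Two sets of `n - f` processors share a
non-faulty one, and the successive views of that one form a chain; hence so do all views on which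
non-faulty processors decide (`decided_subset_or_subset`). The views of the non-faulty processors
only grow and end up equal, so everybody decides (`exists_decided`).

*Output*. For a view `M` let `U M` be the set of those `u` that bound from above all but at most
`f` values in `M` (`almostUpperBounds`). The output is the greatest lower bound of `U M`. As `U` is
antitone in `M`, the output is monotone in `M`, so views that form a chain yield outputs that form
a chain. The join of the inputs of non-faulty processors belongs to `U M`, because `M` has at most
`f` pairs of faulty processors, and this gives the upper validity constraint. For the lower one it
suffices that more than `f` members of `M` have a value below the output.

The existence of the greatest lower bound (`exists_isGLB_almostUpperBounds`) is where the
hypotheses on `V` enter. If `U M` has no least element, it has two incomparable elements. In a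
cycle-free order their common lower bounds form a chain
(`IsCycleFree.le_or_le_of_common_upperBounds`), so that a greatest lower bound exists once there is
any lower bound. The values of all but `2 * f` members of `M` lie in this chain, which has at most
`ω - 2` elements since it is prolonged by one of the two elements and their join. As `M` has more
than `ω * f` members, some value occurs more than `f` times, and such a value is a lower bound of
`U M`.
-/

/-! ### Semilattices without an induced four-cycle -/

/-- In a cycle-free semilattice the common upper bounds of two incomparable elements form a chain:
two incomparable elements below two incomparable elements are an induced four-cycle. -/
theorem IsCycleFree.le_or_le_of_common_upperBounds {V : Type u} [PartialOrder V]
    (hV : IsCycleFree V) {a b c d : V} (hac : a ≤ c) (had : a ≤ d) (hbc : b ≤ c) (hbd : b ≤ d)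
    (hcd : ¬ c ≤ d) (hdc : ¬ d ≤ c) : a ≤ b ∨ b ≤ a := by
  by_contra! h
  obtain ⟨hab, hba⟩ := h
  have hca : ¬ c ≤ a := fun h => hcd (h.trans had)
  have hda : ¬ d ≤ a := fun h => hdc (h.trans hac)
  have hcb : ¬ c ≤ b := fun h => hcd (h.trans hbd)
  have hdb : ¬ d ≤ b := fun h => hdc (h.trans hbc)
  have hne : ∀ {x y : V}, ¬ x ≤ y → x ≠ y := fun h e => h e.le
  refine (hV 4 le_rfl).false
    ⟨⟨![a, c, b, d], fun i j h => ?_⟩, fun {i j} => ?_⟩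
  · fin_cases i <;> fin_cases j <;>
      first
      | rfl
      | exact absurd h (hne ‹_›)
      | exact absurd h.symm (hne ‹_›)
  · fin_cases i <;> fin_cases j <;>
      first
      | exact iff_of_false (fun h => h.1 rfl) (by decide)
      | exact iff_of_false (fun h => h.2.elim (by assumption) (by assumption)) (by decide)
      | exact iff_of_true ⟨hne (by assumption), Or.inr (by assumption)⟩ (by decide)
      | exact iff_of_true ⟨(hne (by assumption)).symm, Or.inl (by assumption)⟩ (by decide)

theorem Finset.card_le_of_isChain_of_chainHeight_eq {V : Type u} [LE V] {ω : ℕ}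
    (hω : (Set.univ : Set V).chainHeight (· ≤ ·) = (ω : ℕ∞)) {s : Finset V}
    (hs : IsChain (· ≤ ·) (s : Set V)) : s.card ≤ ω := by
  have h := Set.encard_le_chainHeight_of_isChain Set.univ (s : Set V) (Set.subset_univ _) hs
  rw [hω, Set.encard_coe_eq_coe_finsetCard] at h
  exact_mod_cast h

theorem subsingleton_of_chainHeight_le_one {V : Type u} [SemilatticeSup V] {ω : ℕ}
    (hω : (Set.univ : Set V).chainHeight (· ≤ ·) = (ω : ℕ∞)) (h1 : ω ≤ 1) : Subsingleton V := by
  classical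
  have key : ∀ {a b : V}, a ≤ b → a = b := fun {a b} hab => by
    by_contra hne
    have := Finset.card_le_of_isChain_of_chainHeight_eq hω (s := {a, b})
      (by simpa using IsChain.pair hab)
    rw [Finset.card_pair hne] at this
    omega
  exact ⟨fun a b => (key (le_sup_left : a ≤ a ⊔ b)).trans (key le_sup_right).symm⟩

section AlmostUpperBounds

variable {V : Type u} [SemilatticeSup V] {α : Type*}

open Classical in
/-- The upper bounds of the values of a finite family after the removal of up to `f` of its
members. -/
def almostUpperBounds (f : ℕ) (M : Finset α) (val : α → V) : Set V :=
  {u | (M.filter fun e => ¬ val e ≤ u).card ≤ f}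

theorem almostUpperBounds_anti (f : ℕ) {M N : Finset α} (h : M ⊆ N) (val : α → V) :
    almostUpperBounds f N val ⊆ almostUpperBounds f M val := by
  classical
  exact fun u hu => (Finset.card_le_card (Finset.filter_subset_filter _ h)).trans hu

open Classical in
theorem card_le_add_card_filter_le {f : ℕ} {M : Finset α} {val : α → V} {u : V}
    (hu : u ∈ almostUpperBounds f M val) :
    M.card ≤ f + (M.filter fun e => val e ≤ u).card := by
  have h := Finset.card_filter_add_card_filter_not (s := M) (fun e => val e ≤ u)
  have h' : (M.filter fun e => ¬ val e ≤ u).card ≤ f := hu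
  omega

open Classical in
/-- A value that a family takes more than `f` times survives every removal of `f` members. -/
theorem mem_lowerBounds_almostUpperBounds {f : ℕ} {M : Finset α} {val : α → V} {c : V}
    (hc : f < (M.filter fun e => val e = c).card) :
    c ∈ lowerBounds (almostUpperBounds f M val) := by
  intro u hu
  by_contra hcu
  refine absurd (hc.trans_le (Finset.card_le_card ?_)) (not_lt.mpr hu)
  exact Finset.monotone_filter_right M fun e _ (he : val e = c) => he ▸ hcu

open Classical in
/-- Either the almost upper bounds have a least element, or two of them are incomparable. In the
latter case cycle-freeness makes the common lower bounds of these two a chain, which is at least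
two steps shorter than a longest chain, and the pigeonhole principle yields a value of high
multiplicity. -/
theorem exists_isGLB_almostUpperBounds [Finite V] (hV : IsCycleFree V) {ω f : ℕ}
    (hω : (Set.univ : Set V).chainHeight (· ≤ ·) = (ω : ℕ∞)) {M : Finset α} (val : α → V)
    (h2 : 2 * f < M.card) (hM : ω * f < M.card) :
    ∃ y, IsGLB (almostUpperBounds f M val) y ∧ f < (M.filter fun e => val e ≤ y).card := by
  have hne : (almostUpperBounds f M val).Nonempty := by
    have hMne : M.Nonempty := Finset.card_pos.mp (by omega)
    refine ⟨M.sup' hMne val, ?_⟩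
    have : (M.filter fun e => ¬ val e ≤ M.sup' hMne val) = ∅ :=
      Finset.filter_eq_empty_iff.mpr fun e he => not_not.mpr (Finset.le_sup' val he)
    simp [almostUpperBounds, this]
  obtain ⟨u₁, hu₁⟩ := (Set.toFinite (almostUpperBounds f M val)).exists_minimal hne
  by_cases hleast : u₁ ∈ lowerBounds (almostUpperBounds f M val)
  · exact ⟨u₁, IsLeast.isGLB ⟨hu₁.prop, hleast⟩, by
      have := card_le_add_card_filter_le hu₁.prop; omega⟩
  obtain ⟨u₂, hu₂, h12⟩ : ∃ u₂ ∈ almostUpperBounds f M val, ¬ u₁ ≤ u₂ := by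
    simpa [lowerBounds] using hleast
  have h21 : ¬ u₂ ≤ u₁ := fun h => h12 (hu₁.le_of_le hu₂ h)
  have hchain : ∀ {a b : V}, a ≤ u₁ → a ≤ u₂ → b ≤ u₁ → b ≤ u₂ → a ≤ b ∨ b ≤ a :=
    fun ha₁ ha₂ hb₁ hb₂ => hV.le_or_le_of_common_upperBounds ha₁ ha₂ hb₁ hb₂ h12 h21
  obtain ⟨c, hc⟩ : ∃ c, f < (M.filter fun e => val e = c).card := by
    set T := M.filter fun e => val e ≤ u₁ ∧ val e ≤ u₂ with hT
    have hTcard : M.card ≤ T.card + 2 * f := by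
      have hsub : M ⊆ T ∪ ((M.filter fun e => ¬ val e ≤ u₁) ∪
          (M.filter fun e => ¬ val e ≤ u₂)) := by
        intro e he
        simp only [hT, Finset.mem_union, Finset.mem_filter]
        tauto
      have h1 : (M.filter fun e => ¬ val e ≤ u₁).card ≤ f := hu₁.prop
      have h2 : (M.filter fun e => ¬ val e ≤ u₂).card ≤ f := hu₂
      have := (Finset.card_le_card hsub).trans ((Finset.card_union_le _ _).trans
        (Nat.add_le_add_left (Finset.card_union_le _ _) _))
      omega
    have hCle : ∀ c ∈ T.image val, c ≤ u₁ ∧ c ≤ u₂ := by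
      intro c hc
      obtain ⟨e, he, rfl⟩ := Finset.mem_image.mp hc
      exact (Finset.mem_filter.mp he).2
    -- The chain of the values below both `u₁` and `u₂` is prolonged by `u₁ < u₁ ⊔ u₂`.
    have hCcard : (T.image val).card + 2 ≤ ω := by
      have hu₁C : u₁ ∉ T.image val := fun h => h12 (hCle _ h).2
      have hsC : u₁ ⊔ u₂ ∉ insert u₁ (T.image val) := by
        intro h
        rcases Finset.mem_insert.mp h with h | h
        · exact h21 (le_sup_right.trans h.le)
        · exact h12 (le_sup_left.trans (hCle _ h).2)
      have hcard : (insert (u₁ ⊔ u₂) (insert u₁ (T.image val))).card = (T.image val).card + 2 := by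
        rw [Finset.card_insert_of_notMem hsC, Finset.card_insert_of_notMem hu₁C]
      rw [← hcard]
      refine Finset.card_le_of_isChain_of_chainHeight_eq hω ?_
      rw [Finset.coe_insert, Finset.coe_insert]
      refine IsChain.insert (IsChain.insert ?_ ?_) ?_
      · intro a ha b hb _
        exact hchain (hCle a ha).1 (hCle a ha).2 (hCle b hb).1 (hCle b hb).2
      · exact fun b hb _ => Or.inr (hCle b hb).1
      · rintro b (rfl | hb) _
        · exact Or.inr le_sup_left
        · exact Or.inr ((hCle b hb).1.trans le_sup_left)
    have hlt : (T.image val).card * f < T.card := by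
      have := Nat.mul_le_mul_right f hCcard
      rw [Nat.add_mul] at this
      omega
    obtain ⟨c, -, hc⟩ := Finset.exists_lt_card_fiber_of_mul_lt_card_of_maps_to
      (fun e he => Finset.mem_image_of_mem val he) hlt
    exact ⟨c, hc.trans_le
      (Finset.card_le_card (Finset.filter_subset_filter _ (Finset.filter_subset _ _)))⟩
  have hclb := mem_lowerBounds_almostUpperBounds hc
  obtain ⟨y, hy⟩ :=
    (Set.toFinite (lowerBounds (almostUpperBounds f M val))).exists_maximal ⟨c, hclb⟩
  have hgreat : y ∈ upperBounds (lowerBounds (almostUpperBounds f M val)) := by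
    intro z hz
    rcases hchain (hz hu₁.prop) (hz hu₂) (hy.prop hu₁.prop) (hy.prop hu₂) with h | h
    · exact h
    · exact hy.le_of_ge hz h
  refine ⟨y, ⟨hy.prop, hgreat⟩, hc.trans_le (Finset.card_le_card ?_)⟩
  exact Finset.monotone_filter_right M fun e _ (he : val e = c) => he ▸ hgreat hclb

end AlmostUpperBounds

/-! ### The protocol -/

namespace AsyncModel

section Protocol

variable {n : ℕ} {V : Type u}

/-- The messages of the protocol. The first three kinds are those of a reliable broadcast of the
inputs. A pair `(k, v)` stands for the claim that processor `k` has input `v`. -/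
inductive ViewMessage (n : ℕ) (V : Type u) : Type u
  /-- the sender has input `v` -/
  | init (v : V)
  /-- `v` is the first input that `k` announced to the sender -/
  | echo (k : Fin n) (v : V)
  /-- no input of `k` other than `v` can be delivered by a non-faulty processor -/
  | ready (k : Fin n) (v : V)
  /-- at some time, `M` was the set of all pairs delivered by the sender -/
  | view (M : Finset (Fin n × V))

instance [Finite V] : Finite (ViewMessage n V) := by
  let g : ViewMessage n V → V ⊕ (Fin n × V) ⊕ (Fin n × V) ⊕ Finset (Fin n × V)
    | .init v => .inl v
    | .echo k v => .inr (.inl (k, v))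
    | .ready k v => .inr (.inr (.inl (k, v)))
    | .view M => .inr (.inr (.inr M))
  refine Finite.of_injective g fun a b h => ?_
  cases a <;> cases b <;> simp_all [g]

/-- The local state of a processor: the received messages with their senders, the messages sent
to all processors, and the view on which the processor has decided, if any. -/
structure ViewState (n : ℕ) (V : Type u) : Type u where
  got : Finset (Fin n × ViewMessage n V)
  sent : Finset (ViewMessage n V)
  decided : Option (Finset (Fin n × V))

instance [Finite V] : Finite (ViewState n V) :=
  Finite.of_injective (fun s : ViewState n V => (s.got, s.sent, s.decided)) fun s t h => by
    cases s; cases t; simp_all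

open Classical in
/-- The processors from which the message `m` has been received. -/
noncomputable def senders (R : Finset (Fin n × ViewMessage n V)) (m : ViewMessage n V) :
    Finset (Fin n) :=
  Finset.univ.filter fun p => (p, m) ∈ R

/-- The received messages allow to send `ready k v`: either a quorum has echoed `v` for `k`, or
some non-faulty processor has sent `ready k v` before. -/
def IsReady (f : ℕ) (R : Finset (Fin n × ViewMessage n V)) (k : Fin n) (v : V) : Prop :=
  n - f ≤ (senders R (.echo k v)).card ∨ f < (senders R (.ready k v)).card

open Classical in
/-- The pairs `(k, v)` for which `ready k v` has been received from a quorum. -/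
noncomputable def delivered [Fintype V] (f : ℕ) (R : Finset (Fin n × ViewMessage n V)) :
    Finset (Fin n × V) :=
  Finset.univ.filter fun e => n - f ≤ (senders R (.ready e.1 e.2)).card

open Classical in
/-- A view that has been received from a quorum, if there is one. -/
noncomputable def stableView (f : ℕ) (R : Finset (Fin n × ViewMessage n V)) :
    Option (Finset (Fin n × V)) :=
  if h : ∃ M, n - f ≤ (senders R (.view M)).card then some h.choose else none

open Classical in
/-- The messages that a processor in state `s` may send when it receives `m` from `j`. -/
def Enabled [Fintype V] (f : ℕ) (s : ViewState n V) (j : Fin n) (m : ViewMessage n V) :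
    ViewMessage n V → Prop
  | .init _ => False
  | .echo k v => k = j ∧ m = .init v ∧ ∀ v', .echo k v' ∉ s.sent
  | .ready k v => IsReady f (insert (j, m) s.got) k v
  | .view M => M = delivered f (insert (j, m) s.got) ∧ n - f ≤ M.card

open Classical in
/-- The state after the receipt of `m` from `j`. -/
noncomputable def ViewState.step [Fintype V] (f : ℕ) (s : ViewState n V) (j : Fin n)
    (m : ViewMessage n V) : ViewState n V where
  got := insert (j, m) s.got
  sent := s.sent ∪ (Set.toFinite {m' | Enabled f s j m m'}).toFinset
  decided := s.decided.or (stableView f (insert (j, m) s.got))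

/-- Sending every message in `S` to every processor, including the sender. -/
noncomputable def broadcast (S : Finset (ViewMessage n V)) : List (Fin n × ViewMessage n V) :=
  ((Finset.univ : Finset (Fin n)) ×ˢ S).toList

open Classical in
/-- The output for a view: the greatest lower bound of its almost upper bounds, if it exists. -/
noncomputable def viewOutput [SemilatticeSup V] (f : ℕ) (M : Finset (Fin n × V)) : Option V :=
  if h : ∃ y, IsGLB (almostUpperBounds f M Prod.snd) y then some h.choose else none

open Classical in
/-- The stable view protocol: the inputs are broadcast reliably; a processor that has delivered
inputs of at least `n - f` processors announces every change of its view, and it decides on a view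
that `n - f` processors have announced. -/
noncomputable def viewAlgorithm (n f : ℕ) (V : Type u) [SemilatticeSup V] [Fintype V] :
    Algorithm n V where
  State := ViewState n V
  Message := ViewMessage n V
  start _ v := (⟨∅, {.init v}, none⟩, broadcast {.init v})
  receive _ s j m := (s.step f j m, broadcast ((s.step f j m).sent \ s.sent))
  output s := s.decided.bind (viewOutput f)

@[simp]
theorem mem_senders {R : Finset (Fin n × ViewMessage n V)} {m : ViewMessage n V} {p : Fin n} :
    p ∈ senders R m ↔ (p, m) ∈ R := by
  simp [senders]

theorem senders_mono {R R' : Finset (Fin n × ViewMessage n V)} (h : R ⊆ R')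
    (m : ViewMessage n V) : senders R m ⊆ senders R' m :=
  fun _ hp => mem_senders.mpr (h (mem_senders.mp hp))

theorem IsReady.mono {f : ℕ} {R R' : Finset (Fin n × ViewMessage n V)} (h : R ⊆ R') {k : Fin n}
    {v : V} (hR : IsReady f R k v) : IsReady f R' k v :=
  hR.imp (fun hq => hq.trans (Finset.card_le_card (senders_mono h _)))
    (fun hq => hq.trans_le (Finset.card_le_card (senders_mono h _)))

@[simp]
theorem mem_delivered [Fintype V] {f : ℕ} {R : Finset (Fin n × ViewMessage n V)}
    {e : Fin n × V} :
    e ∈ delivered f R ↔ n - f ≤ (senders R (.ready e.1 e.2)).card := by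
  simp [delivered]

theorem delivered_mono [Fintype V] {f : ℕ} {R R' : Finset (Fin n × ViewMessage n V)}
    (h : R ⊆ R') : delivered f R ⊆ delivered f R' := fun _ he =>
  mem_delivered.mpr ((mem_delivered.mp he).trans (Finset.card_le_card (senders_mono h _)))

theorem le_card_senders_of_stableView_eq_some {f : ℕ} {R : Finset (Fin n × ViewMessage n V)}
    {M : Finset (Fin n × V)} (h : stableView f R = some M) :
    n - f ≤ (senders R (.view M)).card := by
  unfold stableView at h
  split_ifs at h with hM
  exact Option.some.inj h ▸ hM.choose_spec

theorem stableView_ne_none {f : ℕ} {R : Finset (Fin n × ViewMessage n V)}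
    {M : Finset (Fin n × V)} (h : n - f ≤ (senders R (.view M)).card) :
    stableView f R ≠ none := by
  unfold stableView
  rw [dif_pos ⟨M, h⟩]
  exact Option.some_ne_none _

@[simp]
theorem mem_broadcast {S : Finset (ViewMessage n V)} {q : Fin n × ViewMessage n V} :
    q ∈ broadcast S ↔ q.2 ∈ S := by
  simp [broadcast]

theorem mem_outgoing_broadcast {S : Finset (ViewMessage n V)} {i : Fin n}
    {e : Envelope n (ViewMessage n V)} :
    e ∈ outgoing i (broadcast S) ↔ e.src = i ∧ e.content ∈ S := by
  simp only [outgoing, Multiset.mem_coe, List.mem_map, mem_broadcast]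
  constructor
  · rintro ⟨q, hq, rfl⟩
    exact ⟨rfl, hq⟩
  · rintro ⟨rfl, he⟩
    exact ⟨(e.dst, e.content), he, rfl⟩

theorem viewOutput_eq_some [SemilatticeSup V] {f : ℕ} {M : Finset (Fin n × V)} {y : V}
    (h : IsGLB (almostUpperBounds f M Prod.snd) y) : viewOutput f M = some y := by
  have hex : ∃ y, IsGLB (almostUpperBounds f M Prod.snd) y := ⟨y, h⟩
  unfold viewOutput
  rw [dif_pos hex, hex.choose_spec.unique h]

section Step

variable [Fintype V] {f : ℕ} {s : ViewState n V} {j : Fin n} {m : ViewMessage n V}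

open Classical in
theorem ViewState.got_subset_step : s.got ⊆ (s.step f j m).got :=
  Finset.subset_insert _ _

open Classical in
theorem ViewState.mem_got_step {q : Fin n × ViewMessage n V} :
    q ∈ (s.step f j m).got ↔ q = (j, m) ∨ q ∈ s.got :=
  Finset.mem_insert

theorem ViewState.mem_sent_step {m' : ViewMessage n V} :
    m' ∈ (s.step f j m).sent ↔ m' ∈ s.sent ∨ Enabled f s j m m' := by
  simp [ViewState.step]

theorem ViewState.sent_subset_step : s.sent ⊆ (s.step f j m).sent :=
  fun _ h => ViewState.mem_sent_step.mpr (Or.inl h)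

theorem ViewState.decided_step_of_eq_some {M : Finset (Fin n × V)} (h : s.decided = some M) :
    (s.step f j m).decided = some M := by
  simp [ViewState.step, h]

/-- The invariant of the local state of a processor with input `v₀`. -/
structure ViewState.Inv (f : ℕ) (v₀ : V) (s : ViewState n V) : Prop where
  init_iff : ∀ v, .init v ∈ s.sent ↔ v = v₀
  echo_unique : ∀ k v v', .echo k v ∈ s.sent → .echo k v' ∈ s.sent → v = v'
  echo_got : ∀ k v, .echo k v ∈ s.sent → (k, .init v) ∈ s.got
  got_echo : ∀ k v, (k, .init v) ∈ s.got → ∃ v', .echo k v' ∈ s.sent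
  ready_iff : ∀ k v, .ready k v ∈ s.sent ↔ IsReady f s.got k v
  view_subset : ∀ M, .view M ∈ s.sent → M ⊆ delivered f s.got ∧ n - f ≤ M.card
  view_chain : ∀ M M', .view M ∈ s.sent → .view M' ∈ s.sent → M ⊆ M' ∨ M' ⊆ M
  view_delivered : n - f ≤ (delivered f s.got).card → .view (delivered f s.got) ∈ s.sent
  decided_quorum : ∀ M, s.decided = some M → n - f ≤ (senders s.got (.view M)).card
  quorum_decided : ∀ M, n - f ≤ (senders s.got (.view M)).card → s.decided ≠ none

theorem ViewState.inv_start (hf : f < n) (v₀ : V) :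
    ViewState.Inv (n := n) f v₀ ⟨∅, {.init v₀}, none⟩ := by
  have hs : ∀ m : ViewMessage n V, senders ∅ m = ∅ := fun m => by simp [senders]
  have hd : delivered (n := n) (V := V) f ∅ = ∅ := by
    simp only [delivered, hs, Finset.card_empty]
    exact Finset.filter_eq_empty_iff.mpr fun _ _ => by omega
  constructor <;> simp [IsReady, hs, hd] <;> omega

theorem ViewState.Inv.step {v₀ : V} (h : s.Inv f v₀) (j : Fin n) (m : ViewMessage n V) :
    (s.step f j m).Inv f v₀ where
  init_iff v := by simp [mem_sent_step, Enabled, h.init_iff]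
  echo_unique k v v' := by
    simp only [mem_sent_step, Enabled]
    rintro (h₁ | ⟨rfl, rfl, h₁⟩) (h₂ | ⟨h₂, h₃, h₄⟩)
    · exact h.echo_unique k v v' h₁ h₂
    · exact absurd h₁ (h₄ v)
    · exact absurd h₂ (h₁ v')
    · simpa using h₃
  echo_got k v := by
    simp only [mem_sent_step, mem_got_step, Enabled]
    rintro (h₁ | ⟨rfl, rfl, -⟩)
    · exact Or.inr (h.echo_got k v h₁)
    · exact Or.inl rfl
  got_echo k v := by
    simp only [mem_sent_step, mem_got_step, Enabled]
    rintro (h₁ | h₁)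
    · obtain ⟨rfl, rfl⟩ := Prod.mk.inj h₁
      by_cases hk : ∃ v', ViewMessage.echo k v' ∈ s.sent
      · exact hk.imp fun _ => Or.inl
      · exact ⟨v, Or.inr ⟨rfl, rfl, not_exists.mp hk⟩⟩
    · exact (h.got_echo k v h₁).imp fun _ => Or.inl
  ready_iff k v := by
    rw [mem_sent_step, h.ready_iff]
    exact or_iff_right_of_imp fun hr => hr.mono (got_subset_step (f := f) (j := j) (m := m))
  view_subset M := by
    simp only [mem_sent_step, Enabled]
    rintro (h₁ | ⟨h₁, h₂⟩)
    · exact ⟨(h.view_subset M h₁).1.trans (delivered_mono got_subset_step),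
        (h.view_subset M h₁).2⟩
    · exact ⟨h₁.le, h₂⟩
  view_chain M M' := by
    have hsub : ∀ {N : Finset (Fin n × V)}, .view N ∈ s.sent →
        N ⊆ delivered f (s.step f j m).got := fun hN =>
      (h.view_subset _ hN).1.trans (delivered_mono got_subset_step)
    simp only [mem_sent_step, Enabled]
    rintro (h₁ | ⟨rfl, -⟩) (h₂ | ⟨rfl, -⟩)
    · exact h.view_chain M M' h₁ h₂
    · exact Or.inl (hsub h₁)
    · exact Or.inr (hsub h₂)
    · exact Or.inl subset_rfl
  view_delivered hc := mem_sent_step.mpr (Or.inr ⟨rfl, hc⟩)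
  decided_quorum M hM := by
    rcases hd : s.decided with _ | M₀
    · refine le_card_senders_of_stableView_eq_some ?_
      simpa [ViewState.step, hd] using hM
    · rw [decided_step_of_eq_some hd] at hM
      obtain rfl := Option.some.inj hM
      exact (h.decided_quorum M₀ hd).trans
        (Finset.card_le_card (senders_mono got_subset_step _))
  quorum_decided M hM := by
    rcases hd : s.decided with _ | M₀
    · simpa [ViewState.step, hd] using stableView_ne_none hM
    · rw [decided_step_of_eq_some hd]
      exact Option.some_ne_none _

end Step

end Protocol

/-! ### Quorums -/

section Quorums

variable {n f : ℕ} {F : Finset (Fin n)}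

theorem exists_notMem_of_lt_card (hF : F.card ≤ f) {S : Finset (Fin n)} (hS : f < S.card) :
    ∃ p ∈ S, p ∉ F := by
  by_contra! h
  exact absurd (Finset.card_le_card h) (by omega)

theorem card_le_card_sdiff_add (hF : F.card ≤ f) (S : Finset (Fin n)) :
    S.card ≤ (S \ F).card + f := by
  have := Finset.le_card_sdiff F S
  omega

/-- Two quorums have a non-faulty processor in common. -/
theorem exists_notMem_mem_mem_of_quorum (hF : F.card ≤ f) (hn : 3 * f < n) {S T : Finset (Fin n)}
    (hS : n - f ≤ S.card) (hT : n - f ≤ T.card) : ∃ p ∉ F, p ∈ S ∧ p ∈ T := by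
  have h₁ := Finset.card_union_add_card_inter S T
  have h₂ := Finset.card_le_univ (S ∪ T)
  rw [Fintype.card_fin] at h₂
  obtain ⟨p, hp, hpF⟩ := exists_notMem_of_lt_card hF (S := S ∩ T) (by omega)
  exact ⟨p, hpF, Finset.mem_inter.mp hp⟩

theorem le_card_compl (hF : F.card ≤ f) : n - f ≤ Fᶜ.card := by
  rw [Finset.card_compl, Fintype.card_fin]
  omega

end Quorums

/-! ### Safety of the protocol -/

theorem run_succ_of_eq_none {n : ℕ} {V : Type u} {A : Algorithm n V} {F : Finset (Fin n)}
    {x : Fin n → V} {τ : Schedule A} {t : ℕ} (h : τ t = none) :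
    run A F x τ (t + 1) = run A F x τ t := by
  simp only [run, h, Option.elim_none]

theorem run_succ_of_eq_some {n : ℕ} {V : Type u} {A : Algorithm n V} {F : Finset (Fin n)}
    {x : Fin n → V} {τ : Schedule A} {t : ℕ} {e : Envelope n A.Message} (h : τ t = some e) :
    run A F x τ (t + 1) = deliver (run A F x τ t) e := by
  simp only [run, h, Option.elim_some]

section Execution

variable {n : ℕ} {V : Type u} [SemilatticeSup V] [Fintype V] {f : ℕ} {F : Finset (Fin n)}
  {x : Fin n → V} {σ : Schedule (viewAlgorithm n f V)}

/-- The local state of processor `i` at time `t` of an execution of the protocol. -/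
noncomputable def viewState (F : Finset (Fin n)) (x : Fin n → V)
    (σ : Schedule (viewAlgorithm n f V)) (t : ℕ) (i : Fin n) : ViewState n V :=
  (run (viewAlgorithm n f V) F x σ t).state i

/-- The messages in transit at time `t` of an execution of the protocol. -/
noncomputable def inTransit (F : Finset (Fin n)) (x : Fin n → V)
    (σ : Schedule (viewAlgorithm n f V)) (t : ℕ) : Multiset (Envelope n (ViewMessage n V)) :=
  (run (viewAlgorithm n f V) F x σ t).pending

theorem viewState_zero (i : Fin n) :
    viewState F x σ 0 i = ⟨∅, {.init (x i)}, none⟩ := rfl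

theorem viewState_succ_of_eq_none {t : ℕ} (h : σ t = none) :
    viewState F x σ (t + 1) = viewState F x σ t :=
  congrArg Config.state (run_succ_of_eq_none h)

theorem inTransit_succ_of_eq_none {t : ℕ} (h : σ t = none) :
    inTransit F x σ (t + 1) = inTransit F x σ t :=
  congrArg Config.pending (run_succ_of_eq_none h)

theorem viewState_succ_of_eq_some {t : ℕ} {e : Envelope n (ViewMessage n V)}
    (h : σ t = some e) (i : Fin n) :
    viewState F x σ (t + 1) i =
      if i = e.dst then (viewState F x σ t i).step f e.src e.content else viewState F x σ t i := by
  refine (congrFun (congrArg Config.state (run_succ_of_eq_some h)) i).trans ?_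
  rcases eq_or_ne i e.dst with rfl | hi
  · rw [if_pos rfl]
    exact Function.update_self ..
  · rw [if_neg hi]
    exact Function.update_of_ne hi ..

theorem mem_inTransit_zero {e : Envelope n (ViewMessage n V)} :
    e ∈ inTransit F x σ 0 ↔ e.src ∉ F ∧ e.content = .init (x e.src) := by
  have : e ∈ inTransit F x σ 0 ↔
      e ∈ ∑ i ∈ Fᶜ, outgoing i (broadcast {ViewMessage.init (x i)}) := Iff.rfl
  rw [this, Multiset.mem_sum]
  simp only [mem_outgoing_broadcast, Finset.mem_compl, Finset.mem_singleton]
  constructor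
  · rintro ⟨i, hi, rfl, h⟩
    exact ⟨hi, h⟩
  · rintro ⟨hi, h⟩
    exact ⟨e.src, hi, rfl, h⟩

open Classical in
theorem inTransit_succ_of_eq_some {t : ℕ} {e : Envelope n (ViewMessage n V)}
    (h : σ t = some e) :
    inTransit F x σ (t + 1) = (inTransit F x σ t).erase e +
      outgoing e.dst (broadcast
        ((viewState F x σ (t + 1) e.dst).sent \ (viewState F x σ t e.dst).sent)) := by
  rw [viewState_succ_of_eq_some h, if_pos rfl]
  exact congrArg Config.pending (run_succ_of_eq_some h)

/-- A property of local states that every step preserves is preserved by the execution. -/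
theorem viewState_succ_induction {P : ViewState n V → Prop} {t : ℕ} {i : Fin n}
    (h : P (viewState F x σ t i)) (hstep : ∀ s j m, P s → P (s.step f j m)) :
    P (viewState F x σ (t + 1) i) := by
  rcases he : σ t with _ | e
  · rwa [viewState_succ_of_eq_none he]
  · rw [viewState_succ_of_eq_some he]
    split_ifs
    · exact hstep _ _ _ h
    · exact h

theorem got_mono (i : Fin n) : Monotone fun t => (viewState F x σ t i).got :=
  monotone_nat_of_le_succ fun t => viewState_succ_induction
    (P := fun s => (viewState F x σ t i).got ⊆ s.got) subset_rfl
    fun _ _ _ h => h.trans ViewState.got_subset_step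

theorem sent_mono (i : Fin n) : Monotone fun t => (viewState F x σ t i).sent :=
  monotone_nat_of_le_succ fun t => viewState_succ_induction
    (P := fun s => (viewState F x σ t i).sent ⊆ s.sent) subset_rfl
    fun _ _ _ h => h.trans ViewState.sent_subset_step

theorem decided_eq_some_of_le {i : Fin n} {M : Finset (Fin n × V)} {t t' : ℕ} (htt' : t ≤ t')
    (h : (viewState F x σ t i).decided = some M) : (viewState F x σ t' i).decided = some M := by
  induction t', htt' using Nat.le_induction with
  | base => exact h
  | succ t' _ ih =>
    exact viewState_succ_induction (P := fun s => s.decided = some M) ih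
      fun _ _ _ => ViewState.decided_step_of_eq_some

theorem viewState_inv (hf : f < n) (t : ℕ) (i : Fin n) : (viewState F x σ t i).Inv f (x i) := by
  induction t with
  | zero => exact ViewState.inv_start hf (x i)
  | succ t ih => exact viewState_succ_induction ih fun _ j m h => h.step j m

theorem content_mem_sent_of_mem_inTransit {t : ℕ} {e : Envelope n (ViewMessage n V)}
    (he : e ∈ inTransit F x σ t) : e.content ∈ (viewState F x σ t e.src).sent := by
  classical
  induction t with
  | zero => simp [viewState_zero, (mem_inTransit_zero.mp he).2]
  | succ t ih =>
    rcases ht : σ t with _ | e'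
    · rw [inTransit_succ_of_eq_none ht] at he
      exact sent_mono _ (Nat.le_succ t) (ih he)
    · rw [inTransit_succ_of_eq_some ht, Multiset.mem_add] at he
      rcases he with he | he
      · exact sent_mono _ (Nat.le_succ t) (ih (Multiset.mem_of_mem_erase he))
      · obtain ⟨h₁, h₂⟩ := mem_outgoing_broadcast.mp he
        rw [h₁]
        exact (Finset.mem_sdiff.mp h₂).1

theorem got_zero (i : Fin n) : (viewState F x σ 0 i).got = ∅ := rfl

/-- What a processor has received from a non-faulty processor by time `t + 1` was sent by time `t`.
The strict inequality of times makes inductions over the first sender of a message possible. -/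
theorem mem_sent_of_mem_got_succ (hσ : IsAdmissible (viewAlgorithm n f V) F x σ) {t : ℕ}
    {i p : Fin n} (hp : p ∉ F) {m : ViewMessage n V}
    (hm : (p, m) ∈ (viewState F x σ (t + 1) i).got) : m ∈ (viewState F x σ t p).sent := by
  induction t with
  | zero =>
    rcases ht : σ 0 with _ | e
    · rw [viewState_succ_of_eq_none ht, got_zero] at hm
      simp at hm
    · rw [viewState_succ_of_eq_some ht] at hm
      split_ifs at hm
      · rw [ViewState.mem_got_step, got_zero] at hm
        obtain ⟨rfl, rfl⟩ : p = e.src ∧ m = e.content := by simpa using hm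
        exact content_mem_sent_of_mem_inTransit ((hσ.possible 0 e ht).2.resolve_left hp)
      · simp [got_zero] at hm
  | succ t ih =>
    have hold : (p, m) ∈ (viewState F x σ (t + 1) i).got →
        m ∈ (viewState F x σ (t + 1) p).sent := fun h => sent_mono p (Nat.le_succ t) (ih h)
    rcases ht : σ (t + 1) with _ | e
    · rw [viewState_succ_of_eq_none ht] at hm
      exact hold hm
    · rw [viewState_succ_of_eq_some ht] at hm
      split_ifs at hm
      · rcases ViewState.mem_got_step.mp hm with hm | hm
        · obtain ⟨rfl, rfl⟩ := Prod.mk.inj hm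
          exact content_mem_sent_of_mem_inTransit ((hσ.possible _ e ht).2.resolve_left hp)
        · exact hold hm
      · exact hold hm

theorem mem_sent_of_mem_got (hσ : IsAdmissible (viewAlgorithm n f V) F x σ) {t : ℕ}
    {i p : Fin n} (hp : p ∉ F) {m : ViewMessage n V}
    (hm : (p, m) ∈ (viewState F x σ t i).got) : m ∈ (viewState F x σ t p).sent :=
  mem_sent_of_mem_got_succ hσ hp (got_mono i (Nat.le_succ t) hm)

/-- Every message sent by a non-faulty processor has been received or is in transit. -/
theorem mem_got_or_mem_inTransit {t : ℕ} {p : Fin n} (hp : p ∉ F) (i : Fin n)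
    {m : ViewMessage n V} (hm : m ∈ (viewState F x σ t p).sent) :
    (p, m) ∈ (viewState F x σ t i).got ∨ ⟨p, i, m⟩ ∈ inTransit F x σ t := by
  classical
  induction t with
  | zero =>
    rw [viewState_zero] at hm
    exact Or.inr (mem_inTransit_zero.mpr ⟨hp, Finset.mem_singleton.mp hm⟩)
  | succ t ih =>
    rcases ht : σ t with _ | e
    · rw [viewState_succ_of_eq_none ht] at hm ⊢
      rw [inTransit_succ_of_eq_none ht]
      exact ih hm
    · rw [inTransit_succ_of_eq_some ht, Multiset.mem_add]
      by_cases hold : m ∈ (viewState F x σ t p).sent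
      · rcases ih hold with h | h
        · exact Or.inl (got_mono i (Nat.le_succ t) h)
        · by_cases he : (⟨p, i, m⟩ : Envelope n (ViewMessage n V)) = e
          · left
            rw [viewState_succ_of_eq_some ht, ← he, if_pos rfl]
            exact ViewState.mem_got_step.mpr (Or.inl rfl)
          · exact Or.inr (Or.inl ((Multiset.mem_erase_of_ne he).mpr h))
      · refine Or.inr (Or.inr (mem_outgoing_broadcast.mpr ?_))
        have hpe : p = e.dst := by
          by_contra hne
          rw [viewState_succ_of_eq_some ht, if_neg hne] at hm
          exact hold hm
        subst hpe
        exact ⟨rfl, Finset.mem_sdiff.mpr ⟨hm, hold⟩⟩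

/-- The first non-faulty processor that sends `ready k v` does so because of a quorum of echoes. -/
theorem exists_echo_quorum_of_ready (hF : F.card ≤ f) (hn : 3 * f < n)
    (hσ : IsAdmissible (viewAlgorithm n f V) F x σ) {t : ℕ} {i : Fin n} (hi : i ∉ F) {k : Fin n}
    {v : V} (h : .ready k v ∈ (viewState F x σ t i).sent) :
    ∃ p ∉ F, n - f ≤ (senders (viewState F x σ t p).got (.echo k v)).card := by
  have hf : f < n := by omega
  induction t generalizing i with
  | zero => simp [viewState_zero] at h
  | succ t ih =>
    rcases ((viewState_inv hf _ i).ready_iff k v).mp h with hq | hq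
    · exact ⟨i, hi, hq⟩
    · obtain ⟨p, hp, hpF⟩ := exists_notMem_of_lt_card hF hq
      obtain ⟨q, hqF, hq⟩ := ih hpF (mem_sent_of_mem_got_succ hσ hpF (mem_senders.mp hp))
      exact ⟨q, hqF, hq.trans (Finset.card_le_card
        (senders_mono (got_mono q (Nat.le_succ t)) _))⟩

theorem exists_echo_quorum_of_mem_delivered (hF : F.card ≤ f) (hn : 3 * f < n)
    (hσ : IsAdmissible (viewAlgorithm n f V) F x σ) {t : ℕ} {i : Fin n} {k : Fin n}
    {v : V} (h : (k, v) ∈ delivered f (viewState F x σ t i).got) :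
    ∃ p ∉ F, n - f ≤ (senders (viewState F x σ t p).got (.echo k v)).card := by
  obtain ⟨p, hp, hpF⟩ := exists_notMem_of_lt_card hF (lt_of_lt_of_le (by omega)
    (mem_delivered.mp h))
  exact exists_echo_quorum_of_ready hF hn hσ hpF
    (mem_sent_of_mem_got hσ hpF (mem_senders.mp hp))

/-- Non-faulty processors deliver at most one input for every processor. -/
theorem delivered_unique (hF : F.card ≤ f) (hn : 3 * f < n)
    (hσ : IsAdmissible (viewAlgorithm n f V) F x σ) {t t' : ℕ} {i i' : Fin n} {k : Fin n}
    {v v' : V} (h : (k, v) ∈ delivered f (viewState F x σ t i).got)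
    (h' : (k, v') ∈ delivered f (viewState F x σ t' i').got) : v = v' := by
  have hf : f < n := by omega
  replace h := delivered_mono (got_mono i (le_max_left t t')) h
  replace h' := delivered_mono (got_mono i' (le_max_right t t')) h'
  obtain ⟨p, -, hq⟩ := exists_echo_quorum_of_mem_delivered hF hn hσ h
  obtain ⟨p', -, hq'⟩ := exists_echo_quorum_of_mem_delivered hF hn hσ h'
  obtain ⟨e, heF, he, he'⟩ := exists_notMem_mem_mem_of_quorum hF hn hq hq'
  exact (viewState_inv hf _ e).echo_unique k v v'
    (mem_sent_of_mem_got hσ heF (mem_senders.mp he))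
    (mem_sent_of_mem_got hσ heF (mem_senders.mp he'))

theorem eq_input_of_init_mem_got (hn : 3 * f < n)
    (hσ : IsAdmissible (viewAlgorithm n f V) F x σ) {t : ℕ} {i k : Fin n} (hk : k ∉ F) {v : V}
    (h : (k, .init v) ∈ (viewState F x σ t i).got) : v = x k :=
  ((viewState_inv (by omega) t k).init_iff v).mp (mem_sent_of_mem_got hσ hk h)

theorem eq_input_of_mem_delivered (hF : F.card ≤ f) (hn : 3 * f < n)
    (hσ : IsAdmissible (viewAlgorithm n f V) F x σ) {t : ℕ} {i k : Fin n} (hk : k ∉ F) {v : V}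
    (h : (k, v) ∈ delivered f (viewState F x σ t i).got) : v = x k := by
  obtain ⟨p, -, hq⟩ := exists_echo_quorum_of_mem_delivered hF hn hσ h
  obtain ⟨e, he, heF⟩ := exists_notMem_of_lt_card hF (lt_of_lt_of_le (by omega) hq)
  exact eq_input_of_init_mem_got hn hσ hk ((viewState_inv (by omega) t e).echo_got k v
    (mem_sent_of_mem_got hσ heF (mem_senders.mp he)))

/-- A view on which a processor decides has at least `n - f` members, and some non-faulty
processor has delivered all of them. -/
theorem exists_subset_delivered_of_decided (hF : F.card ≤ f) (hn : 3 * f < n)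
    (hσ : IsAdmissible (viewAlgorithm n f V) F x σ) {t : ℕ} {i : Fin n}
    {M : Finset (Fin n × V)} (h : (viewState F x σ t i).decided = some M) :
    n - f ≤ M.card ∧ ∃ p, M ⊆ delivered f (viewState F x σ t p).got := by
  have hf : f < n := by omega
  obtain ⟨p, hp, hpF⟩ := exists_notMem_of_lt_card hF
    (lt_of_lt_of_le (by omega) ((viewState_inv hf t i).decided_quorum M h))
  have := (viewState_inv hf t p).view_subset M (mem_sent_of_mem_got hσ hpF (mem_senders.mp hp))
  exact ⟨this.2, p, this.1⟩

/-- Two quorums for views share a non-faulty processor, and the views of a processor only grow. -/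
theorem decided_subset_or_subset (hF : F.card ≤ f) (hn : 3 * f < n)
    (hσ : IsAdmissible (viewAlgorithm n f V) F x σ) {t t' : ℕ} {i i' : Fin n}
    {M M' : Finset (Fin n × V)} (h : (viewState F x σ t i).decided = some M)
    (h' : (viewState F x σ t' i').decided = some M') : M ⊆ M' ∨ M' ⊆ M := by
  have hf : f < n := by omega
  obtain ⟨p, hpF, hp, hp'⟩ := exists_notMem_mem_mem_of_quorum hF hn
    ((viewState_inv hf _ i).decided_quorum M (decided_eq_some_of_le (le_max_left t t') h))
    ((viewState_inv hf _ i').decided_quorum M' (decided_eq_some_of_le (le_max_right t t') h'))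
  exact (viewState_inv hf _ p).view_chain M M'
    (mem_sent_of_mem_got hσ hpF (mem_senders.mp hp))
    (mem_sent_of_mem_got hσ hpF (mem_senders.mp hp'))

/-! ### Termination of the protocol -/

open Filter

theorem eventually_mem_got (hσ : IsAdmissible (viewAlgorithm n f V) F x σ) {t₀ : ℕ} {p i : Fin n}
    (hp : p ∉ F) (hi : i ∉ F) {m : ViewMessage n V} (hm : m ∈ (viewState F x σ t₀ p).sent) :
    ∀ᶠ t in atTop, (p, m) ∈ (viewState F x σ t i).got := by
  suffices h : ∃ t, (p, m) ∈ (viewState F x σ t i).got by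
    obtain ⟨t, ht⟩ := h
    filter_upwards [eventually_ge_atTop t] with t' htt' using got_mono i htt' ht
  rcases mem_got_or_mem_inTransit hp i hm with h | h
  · exact ⟨t₀, h⟩
  · obtain ⟨t', -, ht'⟩ := hσ.delivered t₀ _ h hi
    refine ⟨t' + 1, ?_⟩
    rw [viewState_succ_of_eq_some ht', if_pos rfl]
    exact ViewState.mem_got_step.mpr (Or.inl rfl)

theorem eventually_subset_senders (hσ : IsAdmissible (viewAlgorithm n f V) F x σ) {i : Fin n}
    (hi : i ∉ F) {m : ViewMessage n V} {S : Finset (Fin n)}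
    (hS : ∀ p ∈ S, p ∉ F ∧ ∃ t, m ∈ (viewState F x σ t p).sent) :
    ∀ᶠ t in atTop, S ⊆ senders (viewState F x σ t i).got m := by
  have : ∀ᶠ t in atTop, ∀ p ∈ S, (p, m) ∈ (viewState F x σ t i).got := by
    rw [eventually_all_finset]
    intro p hp
    obtain ⟨hpF, t, ht⟩ := hS p hp
    exact eventually_mem_got hσ hpF hi ht
  filter_upwards [this] with t ht p hp using mem_senders.mpr (ht p hp)

/-- A message that all non-faulty processors send is eventually received from a quorum. -/
theorem eventually_quorum (hF : F.card ≤ f) (hσ : IsAdmissible (viewAlgorithm n f V) F x σ)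
    {i : Fin n} (hi : i ∉ F) {m : ViewMessage n V}
    (hm : ∀ p ∉ F, ∃ t, m ∈ (viewState F x σ t p).sent) :
    ∀ᶠ t in atTop, n - f ≤ (senders (viewState F x σ t i).got m).card := by
  filter_upwards [eventually_subset_senders hσ hi (S := Fᶜ)
    fun p hp => ⟨Finset.mem_compl.mp hp, hm p (Finset.mem_compl.mp hp)⟩] with t ht
  exact (le_card_compl hF).trans (Finset.card_le_card ht)

/-- What one processor delivers, all non-faulty processors deliver eventually: enough non-faulty
processors have sent the `ready` message to make all others send it, too. -/
theorem eventually_mem_delivered_of_mem_delivered (hF : F.card ≤ f) (hn : 3 * f < n)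
    (hσ : IsAdmissible (viewAlgorithm n f V) F x σ) {t₀ : ℕ} {i₀ i : Fin n} (hi : i ∉ F)
    {e : Fin n × V} (h : e ∈ delivered f (viewState F x σ t₀ i₀).got) :
    ∀ᶠ t in atTop, e ∈ delivered f (viewState F x σ t i).got := by
  simp only [mem_delivered] at h ⊢
  refine eventually_quorum hF hσ hi fun j hj => ?_
  have hcard := card_le_card_sdiff_add hF (senders (viewState F x σ t₀ i₀).got (.ready e.1 e.2))
  obtain ⟨t, ht⟩ := (eventually_subset_senders hσ hj (m := .ready e.1 e.2)
    (S := senders (viewState F x σ t₀ i₀).got (.ready e.1 e.2) \ F) fun p hp => by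
      obtain ⟨hp, hpF⟩ := Finset.mem_sdiff.mp hp
      exact ⟨hpF, t₀, mem_sent_of_mem_got hσ hpF (mem_senders.mp hp)⟩).exists
  refine ⟨t, ((viewState_inv (by omega) t j).ready_iff _ _).mpr (Or.inr ?_)⟩
  exact lt_of_lt_of_le (by omega) (Finset.card_le_card ht)

theorem eventually_input_mem_delivered (hF : F.card ≤ f) (hn : 3 * f < n)
    (hσ : IsAdmissible (viewAlgorithm n f V) F x σ) {i k : Fin n} (hi : i ∉ F) (hk : k ∉ F) :
    ∀ᶠ t in atTop, (k, x k) ∈ delivered f (viewState F x σ t i).got := by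
  have hf : f < n := by omega
  have hecho : ∀ p ∉ F, ∃ t, .echo k (x k) ∈ (viewState F x σ t p).sent := by
    intro p hp
    obtain ⟨t, ht⟩ := (eventually_mem_got hσ hk hp (t₀ := 0)
      (((viewState_inv hf 0 k).init_iff (x k)).mpr rfl)).exists
    obtain ⟨v, hv⟩ := (viewState_inv hf t p).got_echo k (x k) ht
    obtain rfl := eq_input_of_init_mem_got hn hσ hk ((viewState_inv hf t p).echo_got k v hv)
    exact ⟨t, hv⟩
  have hready : ∀ p ∉ F, ∃ t, .ready k (x k) ∈ (viewState F x σ t p).sent := by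
    intro p hp
    obtain ⟨t, ht⟩ := (eventually_quorum hF hσ hp hecho).exists
    exact ⟨t, ((viewState_inv hf t p).ready_iff _ _).mpr (Or.inl ht)⟩
  simpa using eventually_quorum hF hσ hi hready

/-- The views of all non-faulty processors are eventually equal to the set of all pairs that any
of them ever delivers, and then all of them announce this set. -/
theorem exists_decided (hF : F.card ≤ f) (hn : 3 * f < n)
    (hσ : IsAdmissible (viewAlgorithm n f V) F x σ) {i : Fin n} (hi : i ∉ F) :
    ∃ t M, (viewState F x σ t i).decided = some M := by
  classical
  have hf : f < n := by omega
  set D : Finset (Fin n × V) := Finset.univ.filter fun e =>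
    ∃ t, ∃ j ∉ F, e ∈ delivered f (viewState F x σ t j).got with hD
  have hDcard : n - f ≤ D.card := by
    have hsub : Fᶜ.image (fun k => (k, x k)) ⊆ D := by
      intro e he
      obtain ⟨k, hk, rfl⟩ := Finset.mem_image.mp he
      obtain ⟨t, ht⟩ :=
        (eventually_input_mem_delivered hF hn hσ hi (Finset.mem_compl.mp hk)).exists
      exact Finset.mem_filter.mpr ⟨Finset.mem_univ _, t, i, hi, ht⟩
    refine (le_card_compl hF).trans (le_of_eq_of_le ?_ (Finset.card_le_card hsub))
    exact (Finset.card_image_of_injective _ fun a b h => congrArg Prod.fst h).symm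
  have hview : ∀ p ∉ F, ∃ t, .view D ∈ (viewState F x σ t p).sent := by
    intro p hp
    have : ∀ᶠ t in atTop, ∀ e ∈ D, e ∈ delivered f (viewState F x σ t p).got := by
      rw [eventually_all_finset]
      intro e he
      obtain ⟨t, j, -, ht⟩ := (Finset.mem_filter.mp he).2
      exact eventually_mem_delivered_of_mem_delivered hF hn hσ hp ht
    obtain ⟨t, ht⟩ := this.exists
    have heq : delivered f (viewState F x σ t p).got = D :=
      Finset.Subset.antisymm
        (fun e he => Finset.mem_filter.mpr ⟨Finset.mem_univ _, t, p, hp, he⟩) ht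
    refine ⟨t, ?_⟩
    have := (viewState_inv (F := F) (x := x) (σ := σ) hf t p).view_delivered
    rw [heq] at this
    exact this hDcard
  obtain ⟨t, ht⟩ := (eventually_quorum hF hσ hi hview).exists
  exact ⟨t, Option.ne_none_iff_exists'.mp ((viewState_inv hf t i).quorum_decided D ht)⟩

/-! ### Semilattice agreement -/

theorem decides_of_decided {i : Fin n} {t : ℕ} {M : Finset (Fin n × V)} {y : V}
    (h : (viewState F x σ t i).decided = some M) (hy : viewOutput f M = some y) :
    Decides (viewAlgorithm n f V) F x σ i y := by
  classical
  have hex : ∃ t, (viewState F x σ t i).decided ≠ none := ⟨t, by simp [h]⟩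
  have hout : ∀ t, (viewAlgorithm n f V).output ((run (viewAlgorithm n f V) F x σ t).state i) =
      (viewState F x σ t i).decided.bind (viewOutput f) := fun _ => rfl
  refine ⟨Nat.find hex, fun s hs => ?_, fun s hs => ?_⟩
  · rw [hout, not_not.mp (Nat.find_min hex hs)]
    rfl
  · obtain ⟨N, hN⟩ := Option.ne_none_iff_exists'.mp (Nat.find_spec hex)
    have hNM : N = M := Option.some.inj
      ((decided_eq_some_of_le (le_max_left _ t) hN).symm.trans
        (decided_eq_some_of_le (le_max_right (Nat.find hex) t) h))
    rw [hout, decided_eq_some_of_le hs hN, hNM]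
    exact hy

/-- Agreement holds since the greatest lower bounds of the almost upper bounds are monotone in the
view, and validity since at most `f` pairs in a view belong to faulty processors. -/
theorem viewAlgorithm_solves (hV : IsCycleFree V) {ω : ℕ}
    (hω : (Set.univ : Set V).chainHeight (· ≤ ·) = (ω : ℕ∞)) (hn : 3 * f < n)
    (hωn : (ω + 1) * f < n) : SolvesSemilatticeAgreement (viewAlgorithm n f V) f := by
  classical
  intro F hF x σ hσ
  have hdec : ∀ i, ∃ M, i ∉ F → ∃ t, (viewState F x σ t i).decided = some M := by
    intro i
    by_cases hi : i ∈ F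
    · exact ⟨∅, fun h => absurd hi h⟩
    · obtain ⟨t, M, h⟩ := exists_decided hF hn hσ hi
      exact ⟨M, fun _ => ⟨t, h⟩⟩
  choose M hM using hdec
  have hout : ∀ i, ∃ y, i ∉ F → IsGLB (almostUpperBounds f (M i) Prod.snd) y ∧
      f < ((M i).filter fun e => e.2 ≤ y).card := by
    intro i
    by_cases hi : i ∈ F
    · exact ⟨x i, fun h => absurd hi h⟩
    · obtain ⟨t, ht⟩ := hM i hi
      have hcard := (exists_subset_delivered_of_decided hF hn hσ ht).1
      rw [Nat.add_mul, Nat.one_mul] at hωn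
      obtain ⟨y, hy⟩ := exists_isGLB_almostUpperBounds hV hω (f := f) (M := M i) Prod.snd
        (by omega) (by omega)
      exact ⟨y, fun _ => hy⟩
  choose y hy using hout
  -- The pairs of faulty processors in a view are few, since their first components are distinct.
  have hfaulty : ∀ i ∉ F, ((M i).filter fun e => e.1 ∈ F).card ≤ f := by
    intro i hi
    obtain ⟨t, ht⟩ := hM i hi
    obtain ⟨-, p, hp⟩ := exists_subset_delivered_of_decided hF hn hσ ht
    refine (Finset.card_le_card_of_injOn Prod.fst (fun e he => (Finset.mem_filter.mp he).2)
      ?_).trans hF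
    rintro ⟨k, v⟩ he ⟨k', v'⟩ he' (rfl : k = k')
    have := delivered_unique hF hn hσ (hp (Finset.mem_filter.mp he).1)
      (hp (Finset.mem_filter.mp he').1)
    rw [this]
  have hinput : ∀ i ∉ F, ∀ e ∈ M i, e.1 ∉ F → e.2 = x e.1 := by
    intro i hi e he heF
    obtain ⟨t, ht⟩ := hM i hi
    obtain ⟨-, p, hp⟩ := exists_subset_delivered_of_decided hF hn hσ ht
    exact eq_input_of_mem_delivered hF hn hσ heF (hp he)
  have hmono : ∀ i ∉ F, ∀ j ∉ F, M i ⊆ M j → y i ≤ y j := fun i hi j hj hij =>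
    (hy j hj).1.mono (hy i hi).1 (almostUpperBounds_anti f hij _)
  refine ⟨y, fun i hi => ?_, fun i hi j hj => ?_, fun i hi => ?_, fun i hi => ?_⟩
  · obtain ⟨t, ht⟩ := hM i hi
    exact decides_of_decided ht (viewOutput_eq_some (hy i hi).1)
  · obtain ⟨t, ht⟩ := hM i hi
    obtain ⟨t', ht'⟩ := hM j hj
    exact (decided_subset_or_subset hF hn hσ ht ht').imp (hmono i hi j hj) (hmono j hj i hi)
  · have hlt : ((M i).filter fun e => e.1 ∈ F).card < ((M i).filter fun e => e.2 ≤ y i).card :=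
      (hfaulty i hi).trans_lt (hy i hi).2
    obtain ⟨e, he, heF⟩ := Finset.exists_mem_notMem_of_card_lt_card hlt
    obtain ⟨heM, hey⟩ := Finset.mem_filter.mp he
    have heF' : e.1 ∉ F := fun h => heF (Finset.mem_filter.mpr ⟨heM, h⟩)
    exact ⟨e.1, heF', hinput i hi e heM heF' ▸ hey⟩
  · refine (hy i hi).1.1 ((Finset.card_le_card ?_).trans (hfaulty i hi))
    refine Finset.monotone_filter_right _ fun e he hle => ?_
    by_contra heF
    refine hle ?_
    rw [hinput i hi e he heF]
    exact Finset.le_sup' x (Finset.mem_compl.mpr heF)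

end Execution

/-- The algorithm without communication, in which every processor decides on its own input. -/
def ownInputAlgorithm (n : ℕ) (V : Type u) : Algorithm n V where
  State := V
  Message := PUnit
  start _ v := (v, [])
  receive _ s _ _ := (s, [])
  output s := some s

/-- With at most one possible value, every decision is right. -/
theorem ownInputAlgorithm_solves (n f : ℕ) (V : Type u) [SemilatticeSup V] [Subsingleton V] :
    SolvesSemilatticeAgreement (ownInputAlgorithm n V) f := fun _ _ x _ _ =>
  ⟨x, fun _ _ => ⟨0, fun _ ht => absurd ht (Nat.not_lt_zero _),
      fun _ _ => congrArg some (Subsingleton.elim (α := V) _ _)⟩,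
    fun _ _ _ _ => Or.inl (Subsingleton.elim _ _).le, fun i hi => ⟨i, hi, le_rfl⟩,
    fun _ _ => (Subsingleton.elim _ _).le⟩

end AsyncModel

theorem mainTheorem2 {V : Type*} [SemilatticeSup V] [Finite V] (hV : IsCycleFree V)
    (ω n f : ℕ) (hω : (Set.univ : Set V).chainHeight (· ≤ ·) = (ω : ℕ∞))
    (hn : (ω + 1) * f < n) :
    ∃ A : AsyncModel.Algorithm n V, Finite A.State ∧ Finite A.Message ∧
      AsyncModel.SolvesSemilatticeAgreement A f := by
  rcases le_or_gt ω 1 with h1 | h2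
  · have := subsingleton_of_chainHeight_le_one hω h1
    exact ⟨AsyncModel.ownInputAlgorithm n V, inferInstanceAs (Finite V),
      inferInstanceAs (Finite PUnit), AsyncModel.ownInputAlgorithm_solves n f V⟩
  · have := Fintype.ofFinite V
    have h3 : 3 * f < n := (Nat.mul_le_mul_right f (by omega)).trans_lt hn
    exact ⟨AsyncModel.viewAlgorithm n f V, inferInstanceAs (Finite (AsyncModel.ViewState n V)),
      inferInstanceAs (Finite (AsyncModel.ViewMessage n V)),
      AsyncModel.viewAlgorithm_solves hV hω h3 hn⟩
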